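/- Let $(\mathsf{x}_i)_{i\in\mathbb N}$ be a real-valued stochastic process and, for $n\in\mathbb N$, let $\mathbf{x}=(\mathsf{x}_1,\dots,\mathsf{x}_n)^{\mathsf T}\in\mathbb R^n$ be its source vector of length $n$. For a nonempty bounded set $U\subset\mathbb R^n$ let $N_U(\rho)$ be the least number of open Euclidean balls of radius $\rho$, with centers in $\mathbb R^n$, that cover $U$, and let $$\underline{\dim}_{\mathrm B}(U)=\liminf_{\rho\to0}\frac{\log N_U(\rho)}{\log(1/\rho)}$$ be the lower Minkowski dimension of $U$. For $\varepsilon>0$ define the lower Minkowski dimension compression rate $$\underline R_{\mathrm B}(\varepsilon)=\limsup_{n\to\infty}\ \inf\Big\{\frac{\underline{\dim}_{\mathrm B}(U)}{n}\ \Big|\ U\subset\mathbb R^n\text{ nonempty and bounded},\ \mathbb P[\mathbf{x}\in U]\ge 1-\varepsilon\Big\}.$$ For $u,v\in\mathbb R^k$ write $u\sim v$ if $u=v$ or $u=-v$, and write $|u|=(|u_1|,\dots,|u_k|)^{\mathsf T}$. **Theorem.** Let $0<\varepsilon<1$ and let $R$ be a real number with $R>\underline R_{\mathrm B}(\varepsilon)$.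 Then $R$ is an $\varepsilon$-achievable rate for Lebesgue almost all measurement matrices, that is: $R>0$, and there is an $N\in\mathbb N$ such that for every $n\ge N$, with $m=\lfloor Rn\rfloor$, for Lebesgue almost every matrix $A\in\mathbb R^{m\times n}$ there is a Borel measurable decoder $g:\mathbb R_{\ge0}^m\to\mathbb R^n$ with $$\mathbb P\big[g(|A\mathbf{x}|)\not\sim\mathbf{x}\big]\le\varepsilon .$$ -/

import Mathlib

open MeasureTheory Filter Topology
open scoped NNReal

/-- The least `k` such that `U ⊆ ℝⁿ` is covered by `k` open Euclidean balls of radius `ρ` with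
centers anywhere in `ℝⁿ`. The minimum exists for bounded `U`
and `ρ > 0`, the only case that is used. -/
noncomputable def coveringNumber {n : ℕ} (U : Set (EuclideanSpace ℝ (Fin n))) (ρ : ℝ) : ℕ :=
  sInf {k : ℕ | ∃ u : Fin k → EuclideanSpace ℝ (Fin n), U ⊆ ⋃ i, Metric.ball (u i) ρ}

/-- The lower Minkowski dimension `liminf_{ρ → 0+} log N_U(ρ) / log (1/ρ)`, taken in the
extended reals. It is used for nonempty bounded `U` only. -/
noncomputable def lowerMinkowskiDim {n : ℕ} (U : Set (EuclideanSpace ℝ (Fin n))) : EReal :=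
  liminf (fun ρ : ℝ => ((Real.log (coveringNumber U ρ) / Real.log (1 / ρ) : ℝ) : EReal)) (𝓝[>] 0)

/-- The source vector of length `n`: the first `n` components of the process. -/
noncomputable def sourceVector {Ω : Type*} (X : ℕ → Ω → ℝ) (n : ℕ) (ω : Ω) :
    EuclideanSpace ℝ (Fin n) :=
  WithLp.toLp 2 (fun i : Fin n => X i ω)

/-- The infimum of `dim U / n`, with `dim` the lower Minkowski dimension, over the nonempty bounded
`U ⊆ ℝⁿ` that contain the source vector of length `n` with probability at least `1 - ε`.
Requiring `U` to be measurable, or closed, would not change the infimum, because `U` and its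
closure have the same lower Minkowski dimension. -/
noncomputable def lowerDimRateAt {Ω : Type*} [MeasurableSpace Ω] (P : Measure Ω)
    (X : ℕ → Ω → ℝ) (ε : ℝ) (n : ℕ) : EReal :=
  sInf {a : EReal | ∃ U : Set (EuclideanSpace ℝ (Fin n)), U.Nonempty ∧ Bornology.IsBounded U ∧
    ENNReal.ofReal (1 - ε) ≤ P {ω | sourceVector X n ω ∈ U} ∧ a = lowerMinkowskiDim U / (n : EReal)}

/-- The lower Minkowski dimension compression rate of the process. -/
noncomputable def lowerMinkowskiRate {Ω : Type*} [MeasurableSpace Ω] (P : Measure Ω)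
    (X : ℕ → Ω → ℝ) (ε : ℝ) : EReal :=
  limsup (fun n : ℕ => lowerDimRateAt P X ε n) atTop

/-- The phaseless measurements `|A x|`, the absolute value being taken entrywise. -/
noncomputable def phaseless {m n : ℕ} (A : Matrix (Fin m) (Fin n) ℝ)
    (x : EuclideanSpace ℝ (Fin n)) : Fin m → ℝ≥0 :=
  fun i => Real.nnabs (A.mulVec x.ofLp i)

/-- Equality up to a global sign. -/
def SignEquiv {n : ℕ} (u v : EuclideanSpace ℝ (Fin n)) : Prop :=
  u = v ∨ u = -v

/-! If `|A y| = |A x|`, each row of `A` is orthogonal to `y - x` or to `y + x`. Cover `U` by `N`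
balls of radius `ρ`. For `y` at distance at least `δ` from `±x` and `A` in a cube, replacing `y` by
the center of its ball puts each row in one of two slabs of width `O(ρ)`, so for fixed `x` the bad
matrices in the cube have volume `O(N ρ^m)`. If the lower dimension of `U` is below `m`, then `N ≤
ρ^(-s)` with `s < m` for arbitrarily small `ρ`, and the bad set is null
(`volume_confusingMatrices_eq_zero`). By Fubini, almost every `A` separates almost every `x` from
all of `closure U`, up to sign. A Borel section of the measurement map on the compact set `closure
U` (`exists_measurable_section`) is then the decoder. -/

/-! ### Borel sections on compact sets -/

/-- A continuous map on a compact set of a metric space has a Borel section over its image. -/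
theorem exists_measurable_section {E Z : Type*} [MetricSpace E] [MeasurableSpace E] [BorelSpace E]
    [TopologicalSpace Z] [T2Space Z] [MeasurableSpace Z] [BorelSpace Z] {K : Set E}
    (hK : IsCompact K) (hne : K.Nonempty) {f : E → Z} (hf : Continuous f) :
    ∃ g : Z → E, Measurable g ∧ ∀ x ∈ K, g (f x) ∈ K ∧ f (g (f x)) = f x := by
  classical
  have : Nonempty K := hne.to_subtype
  have : CompactSpace K := isCompact_iff_compactSpace.mp hK
  obtain ⟨φ, hφ, hsurj⟩ := exists_nat_bool_continuous_surjective_of_compact K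
  let ψ : cantorSet → K := φ ∘ cantorSetHomeomorphNatToBool
  have hψ : Continuous ψ := hφ.comp cantorSetHomeomorphNatToBool.continuous
  have hψs : Function.Surjective ψ := hsurj.comp cantorSetHomeomorphNatToBool.surjective
  have : CompactSpace cantorSet := isCompact_iff_compactSpace.mp isCompact_cantorSet
  have hh : Continuous fun t => f (ψ t) := hf.comp (continuous_subtype_val.comp hψ)
  have hleast : ∀ z ∈ Set.range fun t => f (ψ t), ∃ t, IsLeast {t | f (ψ t) = z} t := by
    rintro z ⟨t, ht⟩
    exact (isClosed_eq hh continuous_const).isCompact.exists_isLeast ⟨t, ht⟩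
  have hcantor : Nonempty cantorSet := ⟨cantorSetHomeomorphNatToBool.symm fun _ => true⟩
  obtain ⟨t₀⟩ := hcantor
  have : Nonempty cantorSet := ⟨t₀⟩
  choose! s hs using hleast
  -- `K` is a continuous image of the Cantor set, whose order inherited from `ℝ` allows a canonical
  -- choice: the least parameter in each fibre.
  let σ : Z → cantorSet := fun z => if z ∈ Set.range fun t => f (ψ t) then s z else t₀
  have hσ : Measurable σ := by
    suffices h : Measurable fun z => (σ z : ℝ) from h.subtype_mk (h := fun z => (σ z).2)
    refine measurable_of_Iic fun a => ?_
    have hR : MeasurableSet (Set.range fun t => f (ψ t)) :=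
      (isCompact_range hh).isClosed.measurableSet
    have hI : MeasurableSet ((fun t => f (ψ t)) '' {t : cantorSet | (t : ℝ) ≤ a}) :=
      ((isClosed_le continuous_subtype_val continuous_const).isCompact.image
        hh).isClosed.measurableSet
    -- By minimality, `σ z ≤ a` on the range iff some parameter of the fibre is at most `a`: the
    -- image of a compact set.
    have heq : (fun z => (σ z : ℝ)) ⁻¹' Set.Iic a =
        (fun t => f (ψ t)) '' {t : cantorSet | (t : ℝ) ≤ a} ∪
          ((Set.range fun t => f (ψ t))ᶜ ∩ {_z | (t₀ : ℝ) ≤ a}) := by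
      ext z
      by_cases hz : z ∈ Set.range fun t => f (ψ t)
      · have h1 : σ z = s z := if_pos hz
        simp only [Set.mem_preimage, Set.mem_Iic, Set.mem_union, Set.mem_inter_iff,
          Set.mem_compl_iff, hz, not_true_eq_false, false_and, or_false, h1]
        constructor
        · intro h
          exact ⟨s z, h, (hs z hz).1⟩
        · rintro ⟨t, ht, htz⟩
          exact le_trans (Subtype.coe_le_coe.mpr ((hs z hz).2 htz)) ht
      · have h1 : σ z = t₀ := if_neg hz
        have h2 : z ∉ (fun t => f (ψ t)) '' {t : cantorSet | (t : ℝ) ≤ a} :=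
          fun h => hz (Set.image_subset_range _ _ h)
        simp only [Set.mem_preimage, Set.mem_Iic, Set.mem_union, Set.mem_inter_iff,
          Set.mem_compl_iff, hz, h1, h2, Set.mem_ofPred_eq, false_or, not_false_eq_true, true_and]
    rw [heq]
    exact hI.union (hR.compl.inter (MeasurableSet.const _))
  refine ⟨fun z => ψ (σ z), (continuous_subtype_val.comp hψ).measurable.comp hσ, fun x hx => ?_⟩
  refine ⟨(ψ _).2, ?_⟩
  obtain ⟨t, ht⟩ := hψs ⟨x, hx⟩
  have hz : f x ∈ Set.range fun t => f (ψ t) := ⟨t, by simp [ht]⟩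
  have h1 : σ (f x) = s (f x) := if_pos hz
  simp only [h1]
  exact (hs _ hz).1

/-! ### Volumes of slabs, and coverings -/

/-- The part of a slab `|⟨a, w⟩| ≤ η` inside a cube has volume of order `η / ‖w‖`. -/
theorem volume_slab_inter_cube_le {n : ℕ} (w : Fin n → ℝ) {d η L : ℝ} (hd : 0 < d) (hw : d ≤ ‖w‖)
    (hη : 0 ≤ η) (hL : 0 ≤ L) :
    volume {a : Fin n → ℝ | (∀ j, |a j| ≤ L) ∧ |a ⬝ᵥ w| ≤ η} ≤
      ENNReal.ofReal (d⁻¹ * (2 * η * (2 * L) ^ (n - 1))) := by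
  classical
  obtain ⟨j, hj⟩ : ∃ j, d ≤ |w j| := by
    by_contra! h
    exact absurd ((pi_norm_lt_iff hd).mpr h) (not_lt.mpr hw)
  -- `M` replaces the `j`-th coordinate of `a` by `a ⬝ᵥ w`, so it sends the truncated slab into a
  -- box, at the cost of a determinant `w j`.
  let M : Matrix (Fin n) (Fin n) ℝ := Matrix.updateRow 1 j w
  have hdet : M.det = w j := by
    have h := Matrix.det_updateRow_sum (1 : Matrix (Fin n) (Fin n) ℝ) j w
    have hsum : (∑ k, w k • (1 : Matrix (Fin n) (Fin n) ℝ) k) = w := by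
      ext i
      simp [Finset.sum_apply, Matrix.one_apply]
    rw [hsum, Matrix.det_one] at h
    simpa using h
  have hwj : 0 < |w j| := hd.trans_le hj
  have hT : LinearMap.det (Matrix.toLin' M) ≠ 0 := by
    rw [LinearMap.det_toLin', hdet]
    exact abs_pos.mp hwj
  let b : Fin n → ℝ := Function.update (fun _ => L) j η
  have hsub : {a : Fin n → ℝ | (∀ j, |a j| ≤ L) ∧ |a ⬝ᵥ w| ≤ η} ⊆
      Matrix.toLin' M ⁻¹' Set.Icc (-b) b := by
    rintro a ⟨ha, haw⟩
    have key : ∀ k, |(Matrix.toLin' M) a k| ≤ b k := by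
      intro k
      by_cases hk : k = j
      · subst hk
        simpa [b, M, Matrix.mulVec, dotProduct_comm] using haw
      · simpa [b, M, Matrix.mulVec, hk, Matrix.updateRow_ne, Matrix.one_apply, dotProduct]
          using ha k
    exact ⟨fun k => (abs_le.mp (key k)).1, fun k => (abs_le.mp (key k)).2⟩
  refine (measure_mono hsub).trans ?_
  rw [Measure.addHaar_preimage_linearMap _ hT, Real.volume_Icc_pi,
    ← ENNReal.ofReal_prod_of_nonneg, ← ENNReal.ofReal_mul (abs_nonneg _)]
  · refine ENNReal.ofReal_le_ofReal ?_
    have hprod : ∏ i, (b i - (-b) i) = 2 * η * (2 * L) ^ (n - 1) := by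
      have : (fun i => b i - (-b) i) = Function.update (fun _ => 2 * L) j (2 * η) := by
        ext k
        by_cases hk : k = j
        · subst hk; simp [b]; ring
        · simp [b, hk]; ring
      rw [this, Finset.prod_update_of_mem (Finset.mem_univ j)]
      simp [Finset.card_sdiff]
    rw [hprod, LinearMap.det_toLin', hdet, abs_inv]
    gcongr
  · intro k _
    have : 0 ≤ b k := by
      by_cases hk : k = j
      · subst hk; simpa [b] using hη
      · simpa [b, hk] using hL
    simp only [Pi.neg_apply]
    linarith

theorem exists_cover_coveringNumber {n : ℕ} {U : Set (EuclideanSpace ℝ (Fin n))}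
    (hU : Bornology.IsBounded U) {ρ : ℝ} (hρ : 0 < ρ) :
    ∃ u : Fin (coveringNumber U ρ) → EuclideanSpace ℝ (Fin n), U ⊆ ⋃ i, Metric.ball (u i) ρ := by
  have hne : {k : ℕ | ∃ u : Fin k → EuclideanSpace ℝ (Fin n),
      U ⊆ ⋃ i, Metric.ball (u i) ρ}.Nonempty := by
    obtain ⟨t, -, htf, ht⟩ := hU.isCompact_closure.finite_cover_balls hρ
    have := htf.fintype
    let e := Fintype.equivFin t
    refine ⟨Fintype.card t, fun i => e.symm i, fun x hx => ?_⟩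
    obtain ⟨c, hc, hxc⟩ := Set.mem_iUnion₂.mp (ht (subset_closure hx))
    exact Set.mem_iUnion.mpr ⟨e ⟨c, hc⟩, by simpa using hxc⟩
  exact Nat.sInf_mem hne

/-- Finitely many closed balls have a closed union, so passing to the compact set `closure U` costs
no extra balls and no larger radius. -/
theorem exists_dist_le_of_mem_closure {n k : ℕ} {U : Set (EuclideanSpace ℝ (Fin n))} {ρ : ℝ}
    {u : Fin k → EuclideanSpace ℝ (Fin n)} (hu : U ⊆ ⋃ i, Metric.ball (u i) ρ)
    {y : EuclideanSpace ℝ (Fin n)} (hy : y ∈ closure U) : ∃ i, dist y (u i) ≤ ρ := by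
  have hcl : IsClosed (⋃ i, Metric.closedBall (u i) ρ) :=
    isClosed_iUnion_of_finite fun _ => Metric.isClosed_closedBall
  have hsub : closure U ⊆ ⋃ i, Metric.closedBall (u i) ρ :=
    closure_minimal (hu.trans (Set.iUnion_mono fun _ => Metric.ball_subset_closedBall)) hcl
  simpa using hsub hy

theorem abs_dotProduct_le {n : ℕ} {a w : Fin n → ℝ} {L ρ : ℝ} (hL : 0 ≤ L) (ha : ∀ j, |a j| ≤ L)
    (hw : ∀ j, |w j| ≤ ρ) : |a ⬝ᵥ w| ≤ n * (L * ρ) := by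
  calc |a ⬝ᵥ w| ≤ ∑ j, |a j * w j| := Finset.abs_sum_le_sum_abs _ _
    _ ≤ ∑ _j : Fin n, L * ρ := Finset.sum_le_sum fun j _ => by
        rw [abs_mul]; exact mul_le_mul (ha j) (hw j) (abs_nonneg _) hL
    _ = n * (L * ρ) := by simp

theorem abs_coord_sub_le {n : ℕ} (y c : EuclideanSpace ℝ (Fin n)) (j : Fin n) :
    |y j - c j| ≤ dist y c := by
  rw [dist_eq_norm]
  simpa using PiLp.norm_apply_le (y - c) j

/-! ### Confusing matrices form a null set -/

/-- The matrices that fail to distinguish `x` from some `y ∈ K` whose distances to `x` and `-x`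
(in the sup norm) are at least `δ`. -/
def confusingMatrices {n : ℕ} (m : ℕ) (K : Set (EuclideanSpace ℝ (Fin n))) (δ : ℝ)
    (x : EuclideanSpace ℝ (Fin n)) : Set (Fin m → Fin n → ℝ) :=
  {A | ∃ y ∈ K, δ ≤ ‖y.ofLp - x.ofLp‖ ∧ δ ≤ ‖y.ofLp + x.ofLp‖ ∧
    phaseless (Matrix.of A) y = phaseless (Matrix.of A) x}

theorem dotProduct_eq_or_eq_of_phaseless_eq {m n : ℕ} {A : Fin m → Fin n → ℝ}
    {x y : EuclideanSpace ℝ (Fin n)} (h : phaseless (Matrix.of A) y = phaseless (Matrix.of A) x)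
    (r : Fin m) : A r ⬝ᵥ (y.ofLp - x.ofLp) = 0 ∨ A r ⬝ᵥ (y.ofLp + x.ofLp) = 0 := by
  have h1 : |A r ⬝ᵥ y.ofLp| = |A r ⬝ᵥ x.ofLp| := by
    have := congrArg NNReal.toReal (congrFun h r)
    simpa [phaseless, Matrix.mulVec] using this
  rw [dotProduct_sub, dotProduct_add]
  rcases abs_eq_abs.mp h1 with h2 | h2
  · left; linarith
  · right; linarith

/-- Union bound over the `k` centers and the `2 ^ m` choices, row by row, of the sign in `y ∓ x`.
For each choice the rows vary independently, which gives the `m`-th power of a slab volume. -/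
theorem volume_confusingMatrices_inter_cube_le {m n k : ℕ} {U : Set (EuclideanSpace ℝ (Fin n))}
    {δ ρ L : ℝ} (hδ : 0 < δ) (hρ : 0 ≤ ρ) (hρδ : ρ ≤ δ / 2) (hL : 0 ≤ L)
    {u : Fin k → EuclideanSpace ℝ (Fin n)} (hu : U ⊆ ⋃ i, Metric.ball (u i) ρ)
    (x : EuclideanSpace ℝ (Fin n)) :
    volume (confusingMatrices m (closure U) δ x ∩ {A | ∀ r j, |A r j| ≤ L}) ≤
      ENNReal.ofReal (k * (2 ^ m *
        ((δ / 2)⁻¹ * (2 * (n * (L * ρ)) * (2 * L) ^ (n - 1))) ^ m)) := by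
  let w : Fin k → Bool → Fin n → ℝ := fun i b =>
    if b then (u i).ofLp - x.ofLp else (u i).ofLp + x.ofLp
  let S : Fin k → Bool → Set (Fin n → ℝ) := fun i b =>
    {a | (∀ j, |a j| ≤ L) ∧ |a ⬝ᵥ w i b| ≤ n * (L * ρ)}
  -- The norm condition empties `D i s` when the center is too close to `x` or `-x`. The remaining
  -- centers keep distance `δ / 2`, since `ρ ≤ δ / 2`.
  let D : Fin k → (Fin m → Bool) → Set (Fin m → Fin n → ℝ) := fun i s =>
    {A | (∀ b, δ / 2 ≤ ‖w i b‖) ∧ ∀ r, A r ∈ S i (s r)}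
  have hcover : confusingMatrices m (closure U) δ x ∩ {A | ∀ r j, |A r j| ≤ L} ⊆
      ⋃ i, ⋃ s, D i s := by
    rintro A ⟨⟨y, hy, hm, hp, heq⟩, hA⟩
    obtain ⟨i, hi⟩ := exists_dist_le_of_mem_closure hu hy
    have hcoord : ∀ j, |(u i).ofLp j - y.ofLp j| ≤ ρ := fun j => by
      rw [abs_sub_comm]
      exact (abs_coord_sub_le y (u i) j).trans hi
    have hnorm : ‖y.ofLp - (u i).ofLp‖ ≤ ρ :=
      (pi_norm_le_iff_of_nonneg hρ).mpr fun j => by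
        simpa [abs_sub_comm] using hcoord j
    choose! s hs using fun r : Fin m => (show ∃ b : Bool,
        A r ⬝ᵥ (if b then y.ofLp - x.ofLp else y.ofLp + x.ofLp) = 0 by
      rcases dotProduct_eq_or_eq_of_phaseless_eq heq r with h | h
      · exact ⟨true, by simpa using h⟩
      · exact ⟨false, by simpa using h⟩)
    refine Set.mem_iUnion₂.mpr ⟨i, s, ?_, fun r => ⟨hA r, ?_⟩⟩
    · rintro (_ | _)
      · have h : y.ofLp + x.ofLp = (y.ofLp - (u i).ofLp) + ((u i).ofLp + x.ofLp) := by abel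
        have := norm_add_le (y.ofLp - (u i).ofLp) ((u i).ofLp + x.ofLp)
        rw [← h] at this
        simp only [w, Bool.false_eq_true, if_false]
        linarith
      · have h : y.ofLp - x.ofLp = (y.ofLp - (u i).ofLp) + ((u i).ofLp - x.ofLp) := by abel
        have := norm_add_le (y.ofLp - (u i).ofLp) ((u i).ofLp - x.ofLp)
        rw [← h] at this
        simp only [w, if_true]
        linarith
    -- Row `r` annihilates the vector built from `y`, so only the error `u i - y` contributes.
    · have h : A r ⬝ᵥ w i (s r) = A r ⬝ᵥ ((u i).ofLp - y.ofLp) := by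
        rw [← add_zero (A r ⬝ᵥ ((u i).ofLp - y.ofLp)), ← hs r, ← dotProduct_add]
        congr 1
        cases s r
        · simp [w]; abel
        · simp [w]
      rw [h]
      exact abs_dotProduct_le hL (hA r) hcoord
  have hD : ∀ i s, volume (D i s) ≤
      ENNReal.ofReal ((δ / 2)⁻¹ * (2 * (n * (L * ρ)) * (2 * L) ^ (n - 1))) ^ m := by
    intro i s
    by_cases hw : ∀ b, δ / 2 ≤ ‖w i b‖
    · calc volume (D i s) ≤ volume (Set.pi Set.univ fun r => S i (s r)) :=
            measure_mono fun A hA r _ => hA.2 r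
        _ = ∏ r, volume (S i (s r)) := volume_pi_pi _
        _ ≤ ∏ _r : Fin m, ENNReal.ofReal
              ((δ / 2)⁻¹ * (2 * (n * (L * ρ)) * (2 * L) ^ (n - 1))) :=
            Finset.prod_le_prod' fun r _ =>
              volume_slab_inter_cube_le _ (half_pos hδ) (hw _) (by positivity) hL
        _ = _ := by simp
    · have : D i s = ∅ := Set.eq_empty_of_forall_notMem fun A hA => hw hA.1
      simp [this]
  calc _ ≤ volume (⋃ i, ⋃ s, D i s) := measure_mono hcover
    _ ≤ ∑ i, ∑ s, volume (D i s) :=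
        (measure_iUnion_fintype_le _ _).trans
          (Finset.sum_le_sum fun i _ => measure_iUnion_fintype_le _ _)
    _ ≤ ∑ _i : Fin k, ∑ _s : Fin m → Bool,
          ENNReal.ofReal ((δ / 2)⁻¹ * (2 * (n * (L * ρ)) * (2 * L) ^ (n - 1))) ^ m :=
        Finset.sum_le_sum fun i _ => Finset.sum_le_sum fun s _ => hD i s
    _ = _ := by
        have hq : 0 ≤ (δ / 2)⁻¹ * (2 * (n * (L * ρ)) * (2 * L) ^ (n - 1)) := by positivity
        generalize (δ / 2)⁻¹ * (2 * (n * (L * ρ)) * (2 * L) ^ (n - 1)) = q at hq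
        rw [ENNReal.ofReal_mul (by positivity), ENNReal.ofReal_mul (by positivity),
          ENNReal.ofReal_pow hq]
        simp [ENNReal.ofReal_pow]

theorem natCast_le_rpow_of_log_div_log_lt {N : ℕ} {ρ s : ℝ} (hρ : 0 < ρ) (hρ1 : ρ < 1)
    (h : Real.log N / Real.log (1 / ρ) < s) : (N : ℝ) ≤ ρ ^ (-s) := by
  rcases Nat.eq_zero_or_pos N with rfl | hN
  · simpa using Real.rpow_nonneg hρ.le _
  have hlog : 0 < Real.log (1 / ρ) := Real.log_pos (by rw [lt_div_iff₀ hρ]; linarith)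
  rw [div_lt_iff₀ hlog] at h
  rw [← Real.log_le_log_iff (by exact_mod_cast hN) (Real.rpow_pos_of_pos hρ _),
    Real.log_rpow hρ]
  rw [one_div, Real.log_inv] at h
  linarith

/-- Slices of the confusion set are null as soon as the lower Minkowski dimension is less than the
number of measurements. -/
theorem volume_confusingMatrices_eq_zero {m n : ℕ} {U : Set (EuclideanSpace ℝ (Fin n))}
    (hU : Bornology.IsBounded U) (hdim : lowerMinkowskiDim U < ((m : ℝ) : EReal)) {δ : ℝ}
    (hδ : 0 < δ) (x : EuclideanSpace ℝ (Fin n)) :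
    volume (confusingMatrices m (closure U) δ x) = 0 := by
  have hcube : confusingMatrices m (closure U) δ x ⊆
      ⋃ L : ℕ, confusingMatrices m (closure U) δ x ∩ {A | ∀ r j, |A r j| ≤ L} := by
    intro A hA
    obtain ⟨L, hL⟩ := exists_nat_ge ‖A‖
    refine Set.mem_iUnion.mpr ⟨L, hA, fun r j => ?_⟩
    exact ((norm_le_pi_norm (A r) j).trans (norm_le_pi_norm A r)).trans hL
  refine measure_mono_null hcube (measure_iUnion_null fun L => ?_)
  -- A liminf controls the covering number only along some radii tending to `0`. That suffices, as
  -- the set being measured does not depend on `ρ`.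
  obtain ⟨s, hs1, hs2⟩ := EReal.lt_iff_exists_real_btwn.mp hdim
  have hs2' : s < m := by exact_mod_cast hs2
  have hfreq := frequently_lt_of_liminf_lt (h := hs1)
  have hev : ∀ᶠ ρ : ℝ in 𝓝[>] 0, ρ ∈ Set.Ioo 0 (min 1 (δ / 2)) :=
    Ioo_mem_nhdsGT (by positivity)
  let C : ℝ := 2 ^ m * ((δ / 2)⁻¹ * (2 * (n * L) * (2 * L) ^ (n - 1))) ^ m
  have hbound : ∃ᶠ ρ : ℝ in 𝓝[>] 0,
      volume (confusingMatrices m (closure U) δ x ∩ {A | ∀ r j, |A r j| ≤ (L : ℝ)}) ≤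
        ENNReal.ofReal (C * ρ ^ (m - s)) := by
    refine (hfreq.and_eventually hev).mono fun ρ hρ => ?_
    obtain ⟨hlt, hρ0, hρ1⟩ := hρ
    have hlt' : Real.log (coveringNumber U ρ) / Real.log (1 / ρ) < s := by exact_mod_cast hlt
    have h1 : ρ < 1 := hρ1.trans_le (min_le_left _ _)
    have h2 : ρ ≤ δ / 2 := (hρ1.trans_le (min_le_right _ _)).le
    obtain ⟨u, hu⟩ := exists_cover_coveringNumber hU hρ0
    refine (volume_confusingMatrices_inter_cube_le hδ hρ0.le h2 L.cast_nonneg hu x).trans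
      (ENNReal.ofReal_le_ofReal ?_)
    have hN := natCast_le_rpow_of_log_div_log_lt hρ0 h1 hlt'
    have hC : 0 ≤ C := by positivity
    have e1 : (2 : ℝ) ^ m *
        ((δ / 2)⁻¹ * (2 * (n * (L * ρ)) * (2 * L) ^ (n - 1))) ^ m = C * ρ ^ m := by
      simp only [C]
      rw [show (δ / 2)⁻¹ * (2 * (n * (L * ρ)) * (2 * (L : ℝ)) ^ (n - 1)) =
        (δ / 2)⁻¹ * (2 * (n * L) * (2 * L) ^ (n - 1)) * ρ by ring, mul_pow, ← mul_assoc]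
    rw [e1, sub_eq_neg_add, Real.rpow_add hρ0, Real.rpow_natCast]
    calc _ ≤ ρ ^ (-s) * (C * ρ ^ m) := by gcongr
      _ = _ := by ring
  have hlim : Tendsto (fun ρ : ℝ => ENNReal.ofReal (C * ρ ^ (m - s))) (𝓝[>] 0) (𝓝 0) := by
    have h0 : ContinuousAt (fun ρ : ℝ => C * ρ ^ ((m : ℝ) - s)) 0 :=
      continuousAt_const.mul (Real.continuousAt_rpow_const _ _ (Or.inr (by linarith)))
    have h1 : Tendsto (fun ρ : ℝ => C * ρ ^ ((m : ℝ) - s)) (𝓝[>] 0) (𝓝 0) := by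
      have := h0.tendsto
      rw [Real.zero_rpow (by linarith), mul_zero] at this
      exact this.mono_left nhdsWithin_le_nhds
    simpa using ENNReal.tendsto_ofReal h1
  exact le_antisymm (ge_of_tendsto_of_frequently hlim hbound) bot_le

/-! ### From null slices to a Borel decoder -/

theorem continuous_phaseless {m n : ℕ} :
    Continuous fun p : (Fin m → Fin n → ℝ) × EuclideanSpace ℝ (Fin n) =>
      phaseless (Matrix.of p.1) p.2 := by
  unfold phaseless
  refine continuous_pi fun i => NNReal.isEmbedding_coe.continuous_iff.mpr ?_
  simp only [Function.comp_def, Real.coe_nnabs, Matrix.mulVec, dotProduct, Matrix.of_apply]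
  fun_prop

/-- Projecting a closed set along the compact factor `K` keeps it closed. This supplies the joint
measurability that Fubini needs. -/
theorem isClosed_setOf_mem_confusingMatrices {m n : ℕ} {K : Set (EuclideanSpace ℝ (Fin n))}
    (hK : IsCompact K) (δ : ℝ) :
    IsClosed {p : EuclideanSpace ℝ (Fin n) × (Fin m → Fin n → ℝ) |
      p.2 ∈ confusingMatrices m K δ p.1} := by
  have : CompactSpace K := isCompact_iff_compactSpace.mp hK
  let T : Set (K × (EuclideanSpace ℝ (Fin n) × (Fin m → Fin n → ℝ))) :=
    {q | δ ≤ ‖q.1.1.ofLp - q.2.1.ofLp‖ ∧ δ ≤ ‖q.1.1.ofLp + q.2.1.ofLp‖ ∧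
      phaseless (Matrix.of q.2.2) q.1.1 = phaseless (Matrix.of q.2.2) q.2.1}
  have hT : IsClosed T := by
    have h1 : Continuous fun q : K × (EuclideanSpace ℝ (Fin n) × (Fin m → Fin n → ℝ)) =>
        q.1.1.ofLp := (PiLp.continuous_ofLp 2 _).comp (by fun_prop)
    have h2 : Continuous fun q : K × (EuclideanSpace ℝ (Fin n) × (Fin m → Fin n → ℝ)) =>
        q.2.1.ofLp := (PiLp.continuous_ofLp 2 _).comp (by fun_prop)
    refine (isClosed_le continuous_const (h1.sub h2).norm).inter
      ((isClosed_le continuous_const (h1.add h2).norm).inter (isClosed_eq ?_ ?_))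
    · exact continuous_phaseless.comp (by fun_prop :
        Continuous fun q : K × (EuclideanSpace ℝ (Fin n) × (Fin m → Fin n → ℝ)) =>
          (q.2.2, q.1.1))
    · exact continuous_phaseless.comp (by fun_prop :
        Continuous fun q : K × (EuclideanSpace ℝ (Fin n) × (Fin m → Fin n → ℝ)) =>
          (q.2.2, q.2.1))
  convert isClosedMap_snd_of_compactSpace _ hT using 1
  ext p
  constructor
  · rintro ⟨y, hy, h⟩
    exact ⟨(⟨y, hy⟩, p), h, rfl⟩
  · rintro ⟨⟨⟨y, hy⟩, p'⟩, h, rfl⟩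
    exact ⟨y, hy, h⟩

theorem signEquiv_of_forall_notMem_confusingMatrices {m n : ℕ}
    {K : Set (EuclideanSpace ℝ (Fin n))} {A : Fin m → Fin n → ℝ} {x y : EuclideanSpace ℝ (Fin n)}
    (hx : ∀ k : ℕ, A ∉ confusingMatrices m K (1 / ((k : ℝ) + 1)) x) (hy : y ∈ K)
    (h : phaseless (Matrix.of A) y = phaseless (Matrix.of A) x) : SignEquiv y x := by
  by_contra hne
  obtain ⟨h1, h2⟩ := not_or.mp hne
  have h1' : 0 < ‖y.ofLp - x.ofLp‖ :=
    norm_pos_iff.mpr fun h0 => h1 (WithLp.ofLp_injective 2 (sub_eq_zero.mp h0))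
  have h2' : 0 < ‖y.ofLp + x.ofLp‖ :=
    norm_pos_iff.mpr fun h0 => h2 (WithLp.ofLp_injective 2 (eq_neg_of_add_eq_zero_left h0))
  obtain ⟨k, hk⟩ := exists_nat_one_div_lt (lt_min h1' h2')
  exact hx k ⟨y, hy, (hk.trans_le (min_le_left _ _)).le, (hk.trans_le (min_le_right _ _)).le, h⟩

theorem measurable_sourceVector {Ω : Type*} [MeasurableSpace Ω] {X : ℕ → Ω → ℝ}
    (hX : ∀ i, Measurable (X i)) (n : ℕ) : Measurable (sourceVector X n) :=
  (PiLp.continuous_toLp 2 _).measurable.comp (measurable_pi_lambda _ fun i => hX i)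

/-- Phase retrieval on a bounded set of lower Minkowski dimension less than the number of
measurements: almost every matrix admits a Borel decoder that fails only outside the closure of
the set, up to a null event. -/
theorem ae_exists_measurable_decoder {Ω : Type*} [MeasurableSpace Ω] (P : Measure Ω)
    [IsFiniteMeasure P] {m n : ℕ} {x : Ω → EuclideanSpace ℝ (Fin n)} (hx : Measurable x)
    {U : Set (EuclideanSpace ℝ (Fin n))} (hne : U.Nonempty) (hU : Bornology.IsBounded U)
    (hdim : lowerMinkowskiDim U < ((m : ℝ) : EReal)) :
    ∀ᵐ A : Fin m → Fin n → ℝ, ∃ g : (Fin m → ℝ≥0) → EuclideanSpace ℝ (Fin n), Measurable g ∧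
      P {ω | ¬ SignEquiv (g (phaseless (Matrix.of A) (x ω))) (x ω)} ≤
        P (x ⁻¹' closure U)ᶜ := by
  have hK : IsCompact (closure U) := hU.isCompact_closure
  have hae : ∀ᵐ A : Fin m → Fin n → ℝ, ∀ᵐ v ∂(P.map x), ∀ k : ℕ,
      A ∉ confusingMatrices m (closure U) (1 / ((k : ℝ) + 1)) v := by
    simp_rw [ae_all_iff]
    intro k
    have hmeas := (isClosed_setOf_mem_confusingMatrices (m := m) hK
      (1 / ((k : ℝ) + 1))).measurableSet.compl
    -- Every slice at fixed `v` is null in `A`; exchanging the quantifiers fixes `A` first.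
    refine (Measure.ae_ae_comm (μ := P.map x) (ν := volume) hmeas).mp ?_
    refine Eventually.of_forall fun v => ?_
    have := volume_confusingMatrices_eq_zero hU hdim
      (Nat.one_div_pos_of_nat (α := ℝ) (n := k)) v
    exact measure_eq_zero_iff_ae_notMem.mp this
  filter_upwards [hae] with A hA
  obtain ⟨g, hg, hgK⟩ := exists_measurable_section hK hne.closure
    (continuous_phaseless.comp (Continuous.prodMk_right A))
  refine ⟨g, hg, measure_mono_ae ?_⟩
  filter_upwards [ae_of_ae_map hx.aemeasurable hA] with ω hω hbad hmem
  obtain ⟨h1, h2⟩ := hgK (x ω) hmem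
  exact hbad (signEquiv_of_forall_notMem_confusingMatrices hω h1 h2)

/-! ### From the compression rate to the number of measurements -/

theorem lowerMinkowskiDim_nonneg {n : ℕ} (U : Set (EuclideanSpace ℝ (Fin n))) :
    0 ≤ lowerMinkowskiDim U := by
  refine le_liminf_of_le (by isBoundedDefault) ?_
  filter_upwards [Ioo_mem_nhdsGT (zero_lt_one (α := ℝ))] with ρ hρ
  exact_mod_cast div_nonneg (Real.log_natCast_nonneg _)
    (Real.log_nonneg (by rw [le_div_iff₀ hρ.1]; linarith [hρ.2]))

theorem lowerMinkowskiRate_nonneg {Ω : Type*} [MeasurableSpace Ω] (P : Measure Ω)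
    (X : ℕ → Ω → ℝ) (ε : ℝ) : 0 ≤ lowerMinkowskiRate P X ε := by
  refine le_limsup_of_frequently_le (Eventually.of_forall fun n => ?_).frequently
    (by isBoundedDefault)
  refine le_sInf ?_
  rintro a ⟨U, -, -, -, rfl⟩
  exact EReal.div_nonneg (lowerMinkowskiDim_nonneg U) (by exact_mod_cast n.zero_le)

theorem exists_lowerMinkowskiDim_lt {Ω : Type*} [MeasurableSpace Ω] {P : Measure Ω}
    {X : ℕ → Ω → ℝ} {ε R : ℝ} (hR : lowerMinkowskiRate P X ε < (R : EReal)) :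
    ∃ N : ℕ, ∀ n : ℕ, N ≤ n → ∃ U : Set (EuclideanSpace ℝ (Fin n)), U.Nonempty ∧
      Bornology.IsBounded U ∧ ENNReal.ofReal (1 - ε) ≤ P {ω | sourceVector X n ω ∈ U} ∧
      lowerMinkowskiDim U < ((⌊R * (n : ℝ)⌋₊ : ℝ) : EReal) := by
  obtain ⟨S, hS1, hS2⟩ := EReal.lt_iff_exists_real_btwn.mp hR
  have hSR : S < R := by exact_mod_cast hS2
  obtain ⟨N₁, hN₁⟩ := eventually_atTop.mp (eventually_lt_of_limsup_lt hS1)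
  -- For `n ≥ N₂` the gap `(R - S) * n` is at least `1`, which absorbs the loss from the floor.
  obtain ⟨N₂, hN₂⟩ := exists_nat_ge (1 / (R - S))
  refine ⟨max (max N₁ N₂) 1, fun n hn => ?_⟩
  have hn1 : N₁ ≤ n := (le_max_left _ _).trans ((le_max_left _ _).trans hn)
  have hn2 : N₂ ≤ n := (le_max_right _ _).trans ((le_max_left _ _).trans hn)
  have hn0 : 1 ≤ n := (le_max_right _ _).trans hn
  obtain ⟨a, ⟨U, hne, hb, hP, rfl⟩, ha⟩ := sInf_lt_iff.mp (hN₁ n hn1)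
  refine ⟨U, hne, hb, hP, ?_⟩
  have hnpos : (0 : ℝ) < n := by exact_mod_cast hn0
  have h1 : lowerMinkowskiDim U < ((S * n : ℝ) : EReal) := by
    rw [EReal.div_lt_iff (by exact_mod_cast hn0) (EReal.natCast_ne_top n)] at ha
    exact_mod_cast ha
  refine h1.trans ?_
  have h2 : 1 ≤ (R - S) * n := by
    rw [div_le_iff₀ (by linarith)] at hN₂
    have : (N₂ : ℝ) ≤ n := by exact_mod_cast hn2
    nlinarith
  have h3 := Nat.lt_floor_add_one (R * (n : ℝ))
  have : S * n < (⌊R * (n : ℝ)⌋₊ : ℝ) := by linarith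
  exact_mod_cast this

theorem theorem1 {Ω : Type*} [MeasurableSpace Ω] (P : Measure Ω) [IsProbabilityMeasure P]
    (X : ℕ → Ω → ℝ) (hX : ∀ i, Measurable (X i))
    (ε : ℝ) (hε0 : 0 < ε) (hε1 : ε < 1)
    (R : ℝ) (hR : lowerMinkowskiRate P X ε < (R : EReal)) :
    0 < R ∧
      ∃ N : ℕ, ∀ n : ℕ, N ≤ n →
        ∀ᵐ A : Fin ⌊R * (n : ℝ)⌋₊ → Fin n → ℝ,
          ∃ g : (Fin ⌊R * (n : ℝ)⌋₊ → ℝ≥0) → EuclideanSpace ℝ (Fin n), Measurable g ∧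
            P {ω | ¬ SignEquiv (g (phaseless (Matrix.of A) (sourceVector X n ω)))
                (sourceVector X n ω)} ≤ ENNReal.ofReal ε := by
  refine ⟨by exact_mod_cast (lowerMinkowskiRate_nonneg P X ε).trans_lt hR, ?_⟩
  obtain ⟨N, hN⟩ := exists_lowerMinkowskiDim_lt hR
  refine ⟨N, fun n hn => ?_⟩
  obtain ⟨U, hne, hb, hP, hdim⟩ := hN n hn
  have hx := measurable_sourceVector hX n
  filter_upwards [ae_exists_measurable_decoder P hx hne hb hdim] with A hA
  obtain ⟨g, hg, hgP⟩ := hA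
  refine ⟨g, hg, hgP.trans ?_⟩
  rw [prob_compl_eq_one_sub (hx isClosed_closure.measurableSet), tsub_le_iff_left]
  calc (1 : ENNReal) = ENNReal.ofReal (1 - ε) + ENNReal.ofReal ε := by
        rw [← ENNReal.ofReal_add (by linarith) hε0.le]; simp
    _ ≤ _ := by
        gcongr
        exact hP.trans (measure_mono fun ω hω => subset_closure hω)
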